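/- All graphs are finite and simple, and $\mathrm{Aut}(X)$ is the automorphism group of a graph $X$. An arc of $X$ is an ordered pair of adjacent vertices; an arc-orbit is an orbit $\Delta$ of $\mathrm{Aut}(X)$ on arcs, its paired orbit is $\Delta^*=\{(v,u):(u,v)\in\Delta\}$, and $\Delta$ is self-paired if $\Delta=\Delta^*$. If $X$ is vertex-transitive, then the number of arcs of $\Delta$ starting at a vertex $v$ does not depend on $v$; if these numbers are $n_1,\dots,n_t$ for the self-paired arc-orbits and $m_1,m_1,\dots,m_s,m_s$ for the pairs $\{\Delta,\Delta^*\}$ of distinct paired arc-orbits, then the arc-type of $X$ is the marked partition $n_1+\dots+n_t+(m_1+m_1)+\dots+(m_s+m_s)$ (up to the order of its terms). A graph with at least one edge is prime if it is not isomorphic to a Cartesian product of two graphs that have at least one edge each. For a graph $X$, a set $F$ of edges of $X$ and $m\ge1$, the thickened $m$-cover $X(F,m)$ is the graph with vertex set $V(X)\times\mathbb{Z}_m$ in which $(u,i)$ and $(v,j)$ are adjacent if and only if either $\{u,v\}\in E(X)\setminus F$ and $i=j$, or $\{u,v\}\in F$ (with $i,j$ arbitrary). Let $G=C_7\rtimes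 C_6$ be the group of order $42$ generated by elements $a$ of order $6$ and $b$ of order $7$ with $a^{-1}ba=b^3$, let $x=a$ and $y=ba^2$, and let $X$ be the Cayley graph of $G$ with connection set $\{x,y,x^{-1},y^{-1}\}$, in which $u$ and $v$ are adjacent if and only if $vu^{-1}$ lies in this set. Let $F$ be the set of edges of $X$ that are not contained in a triangle. Lemma. The set $F$ is an orbit of $\mathrm{Aut}(X)$ on the edges of $X$. For every integer $m\ge2$, the graph $Y=X(F,m)$ is connected, vertex-transitive and prime, and has arc-type $(m+m)+(1+1)$. Moreover, for every automorphism $\varphi$ of $Y$ there is an automorphism $\psi$ of $X$ such that $\varphi$ maps every vertex of the form $(u,i)$ to a vertex of the form $(\psi(u),j)$; that is, $\varphi$ permutes the fibres $\{u\}\times\mathbb{Z}_m$ and projects to $\psi$. In particular, for every $m\ge2$ there is a prime vertex-transitive graph with arc-type $(m+m)+(1+1)$. -/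

import Mathlib

/-- A graph is vertex-transitive if its automorphism group is transitive on vertices. -/
def IsVertexTransitive {V : Type*} (X : SimpleGraph V) : Prop :=
  ∀ u v : V, ∃ φ : X ≃g X, φ u = v

/-- The orbit of the ordered pair `a` under the automorphism group of `X`. -/
def arcOrbit {V : Type*} (X : SimpleGraph V) (a : V × V) : Set (V × V) :=
  {b | ∃ φ : X ≃g X, (φ a.1, φ a.2) = b}

/-- The set of all orbits of the automorphism group of `X` on the arcs of `X`. -/
def arcOrbits {V : Type*} (X : SimpleGraph V) : Set (Set (V × V)) :=
  {Δ | ∃ u v : V, X.Adj u v ∧ Δ = arcOrbit X (u, v)}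

/-- The paired set `Δ* = {(v, u) : (u, v) ∈ Δ}`. -/
def pairedOrbit {V : Type*} (Δ : Set (V × V)) : Set (V × V) :=
  {a | (a.2, a.1) ∈ Δ}

/-- The number of arcs of `Δ` that start at `v`. -/
noncomputable def localSize {V : Type*} (v : V) (Δ : Set (V × V)) : ℕ :=
  {w | (v, w) ∈ Δ}.ncard

/-- A marked partition `n₁ + ⋯ + n_t + (m₁ + m₁) + ⋯ + (m_s + m_s)`, up to the order of its terms:
`single` is the multiset of the `n_i`, and `bracketed` contains `m_j` once for each bracketed
pair `(m_j + m_j)`. -/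
structure MarkedPartition where
  single : Multiset ℕ
  bracketed : Multiset ℕ

/-- `HasArcType X P`: the arc-type of the (finite, vertex-transitive) graph `X` is `P`. Here `S` is
the set of self-paired arc-orbits, and `T` contains exactly one orbit of each pair `{Δ, Δ*}` of
distinct paired arc-orbits. -/
def HasArcType {V : Type*} (X : SimpleGraph V) (P : MarkedPartition) : Prop :=
  ∃ S T : Finset (Set (V × V)),
    (∀ Δ, Δ ∈ S ↔ Δ ∈ arcOrbits X ∧ pairedOrbit Δ = Δ) ∧
    (∀ Δ ∈ T, Δ ∈ arcOrbits X ∧ pairedOrbit Δ ≠ Δ ∧ pairedOrbit Δ ∉ T) ∧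
    (∀ Δ ∈ arcOrbits X, pairedOrbit Δ ≠ Δ → Δ ∈ T ∨ pairedOrbit Δ ∈ T) ∧
    ∀ v : V, S.val.map (localSize v) = P.single ∧ T.val.map (localSize v) = P.bracketed

/-- A graph with at least one edge is prime if it is not isomorphic to a Cartesian product of two
graphs that have at least one edge each. (If the product is finite, then such factors have fewer
vertices than the product.) -/
def IsCartesianPrime.{u} {V : Type u} (X : SimpleGraph V) : Prop :=
  X ≠ ⊥ ∧ ∀ (A B : Type u) (H : SimpleGraph A) (K : SimpleGraph B),
    H ≠ ⊥ → K ≠ ⊥ → IsEmpty (X ≃g H.boxProd K)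

/-- `F` is an orbit of the automorphism group of `X` on the edges of `X`. -/
def IsEdgeOrbit {V : Type*} (X : SimpleGraph V) (F : Set (Sym2 V)) : Prop :=
  ∃ e ∈ X.edgeSet, F = {f | ∃ φ : X ≃g X, Sym2.map φ e = f}

/-- The set of edges of `X` that are not contained in a triangle. -/
def trianglelessEdges {V : Type*} (X : SimpleGraph V) : Set (Sym2 V) :=
  {e ∈ X.edgeSet | ¬ ∃ w : V, ∀ u ∈ e, X.Adj u w}

/-- The thickened `m`-cover `X(F, m)` of `X` over a set `F` of edges of `X`. -/
def thickenedCover {V : Type*} (X : SimpleGraph V) (F : Set (Sym2 V)) (m : ℕ) :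
    SimpleGraph (V × ZMod m) where
  Adj p q :=
    (X.Adj p.1 q.1 ∧ s(p.1, q.1) ∉ F ∧ p.2 = q.2) ∨ (X.Adj p.1 q.1 ∧ s(p.1, q.1) ∈ F)
  symm := ⟨fun p q h => by
    rw [Sym2.eq_swap, X.adj_comm, eq_comm (a := q.2)]
    exact h⟩
  loopless := ⟨fun p h => by
    rcases h with h | h <;> exact X.irrefl h.1⟩

/-- The Cayley graph `Cay(G, S)` of a group `G` for an inverse-closed subset `S` that does not
contain the identity: `u` and `v` are adjacent if and only if `v * u⁻¹ ∈ S`. -/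
def cayleyGraph {G : Type*} [Group G] (S : Set G) (hone : (1 : G) ∉ S)
    (hinv : ∀ s ∈ S, s⁻¹ ∈ S) : SimpleGraph G where
  Adj u v := v * u⁻¹ ∈ S
  symm := ⟨fun u v h => by simpa using hinv _ h⟩
  loopless := ⟨fun u h => hone (by simpa using h)⟩

/-- The action of `C₆` on `C₇` (written additively as `ℤ/6` and `ℤ/7`) for which the generator of `C₆` acts as `n ↦ 5 n`, the inverse
of `n ↦ 3 n`. -/
def frobeniusAction : Multiplicative (ZMod 6) →* MulAut (Multiplicative (ZMod 7)) where
  toFun i :=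
    { toFun := fun n => Multiplicative.ofAdd (5 ^ (Multiplicative.toAdd i).val * Multiplicative.toAdd n)
      invFun := fun n => Multiplicative.ofAdd (3 ^ (Multiplicative.toAdd i).val * Multiplicative.toAdd n)
      left_inv := by revert i; decide
      right_inv := by revert i; decide
      map_mul' := by intro n n'; simp [mul_add] }
  map_one' := by ext n; revert n; decide
  map_mul' := by
    intro i j; ext n; revert i j n; decide

/-- The group `C₇ ⋊ C₆` of order 42. -/
abbrev FrobeniusGroup : Type := Multiplicative (ZMod 7) ⋊[frobeniusAction] Multiplicative (ZMod 6)

namespace FrobeniusGroup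

/-- The generator of order 6. -/
def a : FrobeniusGroup := SemidirectProduct.inr (Multiplicative.ofAdd 1)

/-- The generator of order 7. -/
def b : FrobeniusGroup := SemidirectProduct.inl (Multiplicative.ofAdd 1)

/-- The defining relation `a⁻¹ b a = b ^ k` for the primitive sixth root of unity `k = 3` modulo 7. -/
theorem inv_a_mul_b_mul_a : a⁻¹ * b * a = b ^ 3 := by decide

/-- The connection set `{x, y, x⁻¹, y⁻¹}` with `x = a` and `y = b a²`. -/
def connectionSet : Set FrobeniusGroup := {a, b * a ^ 2, a⁻¹, (b * a ^ 2)⁻¹}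

theorem one_notMem_connectionSet : (1 : FrobeniusGroup) ∉ connectionSet := by
  simp only [connectionSet, Set.mem_insert_iff, Set.mem_singleton_iff]
  decide

theorem inv_mem_connectionSet : ∀ s ∈ connectionSet, s⁻¹ ∈ connectionSet := by
  rintro s (rfl | rfl | rfl | rfl) <;> simp [connectionSet]

end FrobeniusGroup

/-- The 4-valent Cayley graph on 42 vertices `Cay(C₇ ⋊ C₆, {x, y, x⁻¹, y⁻¹})`. -/
def baseGraph : SimpleGraph FrobeniusGroup :=
  cayleyGraph FrobeniusGroup.connectionSet FrobeniusGroup.one_notMem_connectionSet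
    FrobeniusGroup.inv_mem_connectionSet

/-! Since `y` has order 3, the edges of `baseGraph` in triangles are the `y`-edges and the others
are the `a`-edges. Automorphisms preserve both kinds, up to orientation. The relation `(y * a) ^ 2 =
1` forces one global choice of orientation, and a relator that does not survive inverting both
generators excludes the reversal. Hence automorphisms commute with left multiplication by `a` and
`y` (`baseGraph_iso_apply`).

In the cover, the edges in no triangle are those above `a`-edges. They determine the fibres, so
automorphisms project (`exists_baseGraph_iso`) and cannot merge or reverse the two types of arcs.
Right translations with layer shifts (`coverIso`) show that each type is a single orbit.

For primality, colour the edges of a product by factor: two colours at a vertex force unique squares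
without diagonals. In the cover, fibres of size at least 2 and the group structure rule these out,
so each vertex sees one colour (`colour_eq`), whereas a nontrivial product shows both. -/

namespace FrobeniusGroup

/-- The generator of order 3. -/
def y : FrobeniusGroup := b * a ^ 2

/-- A subset containing `1` and closed under left multiplication by the generators `a` and `y` is
everything. -/
theorem generators_induction {P : FrobeniusGroup → Prop} (one : P 1)
    (ha : ∀ u, P u → P (a * u)) (hy : ∀ u, P u → P (y * u)) (g : FrobeniusGroup) : P g := by
  have hb : ∀ u, P u → P (b * u) := fun u hu => by
    have h : b = y * (a * (a * (a * a))) := by decide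
    rw [h]
    simp only [mul_assoc]
    exact hy _ (ha _ (ha _ (ha _ (ha _ hu))))
  have hpow : ∀ s, (∀ u, P u → P (s * u)) → ∀ (n : ℕ) u, P u → P (s ^ n * u) := by
    intro s hs n
    induction n with
    | zero => simp
    | succ n ih => intro u hu; rw [pow_succ', mul_assoc]; exact hs _ (ih u hu)
  -- Normal form in the semidirect product; positive words suffice because the group is finite.
  have h : g = b ^ (Multiplicative.toAdd g.left).val * (a ^ (Multiplicative.toAdd g.right).val * 1) := by
    obtain ⟨n, i⟩ := g
    revert n i
    decide
  rw [h]
  exact hpow b hb _ _ (hpow a ha _ _ one)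

end FrobeniusGroup

open FrobeniusGroup

/-! ### Automorphisms of the base graph -/

theorem baseGraph_adj {u v : FrobeniusGroup} :
    baseGraph.Adj u v ↔ v = a * u ∨ v = a⁻¹ * u ∨ v = y * u ∨ v = y⁻¹ * u := by
  change v * u⁻¹ ∈ connectionSet ↔ _
  simp only [connectionSet, Set.mem_insert_iff, Set.mem_singleton_iff, mul_inv_eq_iff_eq_mul, y]
  tauto

theorem mem_trianglelessEdges {V : Type*} {X : SimpleGraph V} {u v : V} :
    s(u, v) ∈ trianglelessEdges X ↔ X.Adj u v ∧ ∀ w, X.Adj u w → ¬ X.Adj v w := by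
  simp only [trianglelessEdges, Set.mem_sep_iff, SimpleGraph.mem_edgeSet, Sym2.mem_iff,
    forall_eq_or_imp, forall_eq, not_exists, not_and]

theorem map_mem_trianglelessEdges {V : Type*} {X : SimpleGraph V} (φ : X ≃g X) {u v : V} :
    s(φ u, φ v) ∈ trianglelessEdges X ↔ s(u, v) ∈ trianglelessEdges X := by
  rw [mem_trianglelessEdges, mem_trianglelessEdges, φ.map_adj_iff, φ.surjective.forall]
  simp only [φ.map_adj_iff]

theorem mem_trianglelessEdges_baseGraph {u v : FrobeniusGroup} :
    s(u, v) ∈ trianglelessEdges baseGraph ↔ v = a * u ∨ v = a⁻¹ * u := by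
  rw [mem_trianglelessEdges, baseGraph_adj]
  simp only [baseGraph_adj]
  have ne : ∀ s t z w : FrobeniusGroup, t * s ≠ z → z * w = t * (s * w) → False :=
    fun s t z w h h' => h (mul_right_cancel (h'.trans (mul_assoc _ _ _).symm)).symm
  constructor
  · rintro ⟨h | h | rfl | rfl, hw⟩
    · exact .inl h
    · exact .inr h
    -- The third vertex of the triangle, as `y ^ 3 = 1`.
    · refine absurd (.inr (.inr (.inl ?_))) (hw (y⁻¹ * u) (by simp))
      simp only [← mul_assoc]
      congr 1
    · refine absurd (.inr (.inr (.inr ?_))) (hw (y * u) (by simp))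
      simp only [← mul_assoc]
      congr 1
  · rintro (rfl | rfl)
    · refine ⟨by simp, ?_⟩
      rintro w (rfl | rfl | rfl | rfl) (h | h | h | h) <;> exact ne _ _ _ _ (by decide) h
    · refine ⟨by simp, ?_⟩
      rintro w (rfl | rfl | rfl | rfl) (h | h | h | h) <;> exact ne _ _ _ _ (by decide) h

/-- Every automorphism of the base graph commutes with left multiplication by the generators. -/
theorem baseGraph_iso_apply (ψ : baseGraph ≃g baseGraph) (u : FrobeniusGroup) :
    ψ (a * u) = a * ψ u ∧ ψ (y * u) = y * ψ u := by
  have cancel : ∀ s t v : FrobeniusGroup, s ≠ t → s * v ≠ t * v :=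
    fun s t v h h' => h (mul_right_cancel h')
  have hx : ∀ u, ψ (a * u) = a * ψ u ∨ ψ (a * u) = a⁻¹ * ψ u := fun u => by
    rw [← mem_trianglelessEdges_baseGraph, map_mem_trianglelessEdges,
      mem_trianglelessEdges_baseGraph]
    exact .inl rfl
  have hy : ∀ u, ψ (y * u) = y * ψ u ∨ ψ (y * u) = y⁻¹ * ψ u := fun u => by
    have h1 : baseGraph.Adj (ψ u) (ψ (y * u)) := ψ.map_adj_iff.2 (baseGraph_adj.2 (by simp))
    have h2 : ¬ s(ψ u, ψ (y * u)) ∈ trianglelessEdges baseGraph := by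
      rw [map_mem_trianglelessEdges, mem_trianglelessEdges_baseGraph, not_or]
      exact ⟨cancel _ _ _ (by decide), cancel _ _ _ (by decide)⟩
    rw [mem_trianglelessEdges_baseGraph] at h2
    rw [baseGraph_adj] at h1
    tauto
  -- The relation `(y * a) ^ 2 = 1` is only preserved if all orientations agree.
  have rel : ∀ u, y * (a * (y * (a * u))) = u := fun u => by
    simp only [← mul_assoc]
    exact mul_eq_right.2 (by decide)
  have sign : ∀ u, (ψ (a * u) = a * ψ u ∧ ψ (y * (a * u)) = y * ψ (a * u) ∧
      ψ (a * (y * (a * u))) = a * ψ (y * (a * u))) ∨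
      (ψ (a * u) = a⁻¹ * ψ u ∧ ψ (y * (a * u)) = y⁻¹ * ψ (a * u) ∧
      ψ (a * (y * (a * u))) = a⁻¹ * ψ (y * (a * u))) := fun u => by
    have h := congrArg ψ (rel u)
    rcases hx u with h1 | h1 <;> rcases hy (a * u) with h2 | h2 <;>
      rcases hx (y * (a * u)) with h3 | h3 <;>
      rcases hy (a * (y * (a * u))) with h4 | h4 <;>
      first
      | exact .inl ⟨h1, h2, h3⟩
      | exact .inr ⟨h1, h2, h3⟩
      | (exfalso
         rw [h4, h3, h2, h1] at h
         simp only [← mul_assoc] at h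
         rw [mul_eq_right] at h
         revert h
         decide)
  have ne : ∀ v : FrobeniusGroup, a * v ≠ a⁻¹ * v := fun v => cancel _ _ _ (by decide)
  -- A change of orientation along an `a`-cycle would fold it, against injectivity.
  have hxx : ∀ u, ψ (a * u) = a * ψ u ↔ ψ (a * (a * u)) = a * ψ (a * u) := fun u => by
    have h : ψ (a * (a * u)) ≠ ψ u := by
      rw [ψ.injective.ne_iff, ← mul_assoc, Ne, mul_eq_right]
      decide
    rcases hx u with h1 | h1 <;> rcases hx (a * u) with h2 | h2
    · tauto
    · exact absurd (by rw [h2, h1, inv_mul_cancel_left]) h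
    · exact absurd (by rw [h2, h1, mul_inv_cancel_left]) h
    · exact iff_of_false (h1 ▸ (ne _).symm) (h2 ▸ (ne _).symm)
  have hxyx : ∀ u, ψ (a * u) = a * ψ u ↔ ψ (a * (y * (a * u))) = a * ψ (y * (a * u)) := fun u => by
    rcases sign u with ⟨h1, -, h2⟩ | ⟨h1, -, h2⟩
    · exact iff_of_true h1 h2
    · exact iff_of_false (h1 ▸ (ne _).symm) (h2 ▸ (ne _).symm)
  -- The orientation at `a⁻¹ * u` agrees with those at `u` and at `y * u`.
  have hxy : ∀ u, ψ (a * u) = a * ψ u ↔ ψ (a * (y * u)) = a * ψ (y * u) := fun u => by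
    have h := (hxx (a⁻¹ * u)).symm.trans (hxyx (a⁻¹ * u))
    rwa [mul_inv_cancel_left] at h
  have const : ∀ u, ψ (a * u) = a * ψ u ↔ ψ (a * 1) = a * ψ 1 :=
    generators_induction Iff.rfl (fun u hu => (hxx u).symm.trans hu)
      (fun u hu => (hxy u).symm.trans hu)
  by_cases h : ψ (a * 1) = a * ψ 1
  · refine ⟨(const u).2 h, ?_⟩
    have h1 := (const (a⁻¹ * u)).2 h
    rcases sign (a⁻¹ * u) with ⟨-, h2, -⟩ | ⟨h2, -, -⟩
    · rwa [mul_inv_cancel_left] at h2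
    · exact absurd (h1.symm.trans h2) (ne _)
  · exfalso
    have ha : ∀ u, ψ (a * u) = a⁻¹ * ψ u := fun u =>
      (hx u).resolve_left fun h' => h ((const u).1 h')
    have hy : ∀ u, ψ (y * u) = y⁻¹ * ψ u := fun u => by
      rcases sign (a⁻¹ * u) with ⟨h2, -, -⟩ | ⟨-, h2, -⟩
      · exact absurd ((const _).1 h2) h
      · rwa [mul_inv_cancel_left] at h2
    -- A relator that becomes nontrivial when both generators are inverted.
    have h1 : a * (a * (y * (y * (a * (a * (a * (y * (y * (a * (y * (y * 1)))))))))))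
        = (1 : FrobeniusGroup) := by decide
    have h2 := congrArg ψ h1
    simp only [ha, hy] at h2
    simp only [← mul_assoc] at h2
    rw [mul_eq_right] at h2
    revert h2
    decide

/-! ### Fibres of the cover and projection of automorphisms -/

section Cover

variable {m : ℕ}

/-- The thickened cover of the base graph over the edges that lie in no triangle. -/
local notation "Y" => thickenedCover baseGraph (trianglelessEdges baseGraph) m

theorem cover_adj {p q : FrobeniusGroup × ZMod m} :
    (Y).Adj p q ↔ (q.1 = a * p.1 ∨ q.1 = a⁻¹ * p.1) ∨
      (q.1 = y * p.1 ∨ q.1 = y⁻¹ * p.1) ∧ q.2 = p.2 := by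
  have ne : ∀ s t v : FrobeniusGroup, s ≠ t → s * v ≠ t * v :=
    fun s t v h h' => h (mul_right_cancel h')
  have h1 := ne y a p.1 (by decide)
  have h2 := ne y a⁻¹ p.1 (by decide)
  have h3 := ne y⁻¹ a p.1 (by decide)
  have h4 := ne y⁻¹ a⁻¹ p.1 (by decide)
  simp only [thickenedCover, mem_trianglelessEdges_baseGraph, baseGraph_adj, eq_comm (a := p.2)]
  constructor
  · tauto
  · rintro (h | ⟨h | h, h'⟩)
    · tauto
    · rw [h]; tauto
    · rw [h]; tauto

theorem baseGraph_adj_of_cover_adj {p q : FrobeniusGroup × ZMod m} (h : (Y).Adj p q) :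
    baseGraph.Adj p.1 q.1 :=
  h.elim And.left And.left

/-- Triangles of the cover project to triangles, and each triangle of the base graph lifts to every
layer. -/
theorem mem_trianglelessEdges_cover {p q : FrobeniusGroup × ZMod m} :
    s(p, q) ∈ trianglelessEdges (Y) ↔ q.1 = a * p.1 ∨ q.1 = a⁻¹ * p.1 := by
  rw [← mem_trianglelessEdges_baseGraph]
  constructor
  · intro h
    rw [mem_trianglelessEdges] at h
    obtain ⟨h | h, hw⟩ := h
    · exfalso
      obtain ⟨h1, h2, h3⟩ := h
      rw [mem_trianglelessEdges_baseGraph] at h2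
      rw [baseGraph_adj] at h1
      obtain h1 | h1 : q.1 = y * p.1 ∨ q.1 = y⁻¹ * p.1 := by tauto
      · refine hw (y⁻¹ * p.1, p.2) (cover_adj.2 (by simp)) (cover_adj.2 (.inr ⟨.inl ?_, h3⟩))
        rw [h1, ← mul_assoc]
        congr 1
      · refine hw (y * p.1, p.2) (cover_adj.2 (by simp)) (cover_adj.2 (.inr ⟨.inr ?_, h3⟩))
        rw [h1, ← mul_assoc]
        congr 1
    · exact h.2
  · intro h
    rw [mem_trianglelessEdges] at h ⊢
    exact ⟨.inr ⟨h.1, mem_trianglelessEdges.2 h⟩, fun w h1 h2 =>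
      h.2 w.1 (baseGraph_adj_of_cover_adj h1) (baseGraph_adj_of_cover_adj h2)⟩

/-- An automorphism of the cover preserves the fibres. -/
theorem cover_iso_fst_eq (φ : Y ≃g Y) (u : FrobeniusGroup) (i j : ZMod m) :
    (φ (u, i)).1 = (φ (u, j)).1 := by
  set v := (φ (u, i)).1
  set w := (φ (u, j)).1
  -- Vertices of one fibre have the same neighbours through triangleless edges. The pair `a * v`,
  -- `a⁻¹ * v` determines `v` because `a ^ 4 ≠ 1`.
  have key : ∀ z : FrobeniusGroup, (z = a * v ∨ z = a⁻¹ * v) ↔ (z = a * w ∨ z = a⁻¹ * w) := by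
    intro z
    obtain ⟨q, hq⟩ := φ.surjective (z, 0)
    have hz : z = (φ q).1 := by rw [hq]
    rw [hz, ← mem_trianglelessEdges_cover (p := φ (u, i)),
      ← mem_trianglelessEdges_cover (p := φ (u, j)), map_mem_trianglelessEdges,
      map_mem_trianglelessEdges, mem_trianglelessEdges_cover, mem_trianglelessEdges_cover]
  have h1 := (key (a * v)).1 (.inl rfl)
  have h2 := (key (a⁻¹ * v)).1 (.inr rfl)
  rcases h1 with h1 | h1
  · exact mul_left_cancel h1
  rcases h2 with h2 | h2
  · exfalso
    have h3 : v = a⁻¹ * (a⁻¹ * w) := by rw [← h1, inv_mul_cancel_left]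
    rw [h3] at h2
    simp only [← mul_assoc] at h2
    have := mul_right_cancel h2
    revert this
    decide
  · exact mul_left_cancel h2

/-- An automorphism of the cover projects to an automorphism of the base graph. -/
theorem exists_baseGraph_iso (φ : Y ≃g Y) :
    ∃ ψ : baseGraph ≃g baseGraph, ∀ u i, (φ (u, i)).1 = ψ u := by
  have inv : ∀ (φ φ' : Y ≃g Y), (∀ p, φ' (φ p) = p) → ∀ u, (φ' ((φ (u, 0)).1, 0)).1 = u := by
    intro φ φ' h u
    rw [cover_iso_fst_eq φ' _ 0 (φ (u, 0)).2, Prod.mk.eta, h]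
  have adj : ∀ (φ : Y ≃g Y) u v, baseGraph.Adj u v →
      baseGraph.Adj (φ (u, 0)).1 (φ (v, 0)).1 := by
    intro φ u v h
    refine baseGraph_adj_of_cover_adj (φ.map_adj_iff.2 (cover_adj.2 ?_))
    rw [baseGraph_adj] at h
    tauto
  have h1 := inv φ φ.symm φ.symm_apply_apply
  have h2 := inv φ.symm φ φ.apply_symm_apply
  refine ⟨⟨⟨fun u => (φ (u, 0)).1, fun u => (φ.symm (u, 0)).1, h1, h2⟩, ?_⟩,
    fun u i => cover_iso_fst_eq φ u i 0⟩
  intro u v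
  refine ⟨fun h => ?_, adj φ u v⟩
  have h' := adj φ.symm _ _ h
  simp only [Equiv.coe_fn_mk] at h'
  rwa [h1, h1] at h'

/-- Right translation by `g`, combined with a shift of the layers that is constant on the
triangles of the base graph. -/
def coverIso (g : FrobeniusGroup) (σ : FrobeniusGroup → ZMod m) (hσ : ∀ u, σ (y * u) = σ u) :
    Y ≃g Y where
  toFun p := (p.1 * g, p.2 + σ p.1)
  invFun p := (p.1 * g⁻¹, p.2 - σ (p.1 * g⁻¹))
  left_inv p := by simp
  right_inv p := by simp
  map_rel_iff' {p q} := by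
    have hσ' : ∀ u, σ (y⁻¹ * u) = σ u := fun u => by rw [← hσ, mul_inv_cancel_left]
    simp only [Equiv.coe_fn_mk, cover_adj, ← mul_assoc, mul_left_inj]
    refine or_congr_right (and_congr_right ?_)
    rintro (h | h) <;> simp [h, hσ, hσ']

theorem cover_isVertexTransitive : IsVertexTransitive (Y) := fun p q =>
  ⟨coverIso (p.1⁻¹ * q.1) (fun _ => q.2 - p.2) fun _ => rfl, by simp [coverIso]⟩

/-! ### Arc-orbits and the arc-type -/

variable (m) in
/-- The arcs of the cover that lie above arcs `(u, a * u)`. -/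
def sparseArcs : Set ((FrobeniusGroup × ZMod m) × (FrobeniusGroup × ZMod m)) :=
  {p | p.2.1 = a * p.1.1}

variable (m) in
/-- The arcs of the cover that lie above arcs `(u, y * u)`. -/
def triangleArcs : Set ((FrobeniusGroup × ZMod m) × (FrobeniusGroup × ZMod m)) :=
  {p | p.2 = (y * p.1.1, p.1.2)}

theorem arcOrbit_sparse {p q : FrobeniusGroup × ZMod m} (h : q.1 = a * p.1) :
    arcOrbit (Y) (p, q) = sparseArcs m := by
  obtain ⟨u, i⟩ := p
  obtain ⟨_, j⟩ := q
  obtain rfl : _ = _ := h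
  ext ⟨⟨v, i'⟩, ⟨w, j'⟩⟩
  constructor
  · rintro ⟨φ, hφ⟩
    obtain ⟨ψ, hψ⟩ := exists_baseGraph_iso φ
    have h1 := hψ u i
    have h2 := hψ (a * u) j
    rw [Prod.mk.injEq] at hφ
    rw [hφ.1] at h1
    rw [hφ.2, (baseGraph_iso_apply ψ u).1, ← h1] at h2
    exact h2
  · intro hw
    obtain rfl : w = a * v := hw
    have hT : ∀ h : FrobeniusGroup, (y * h = 1 ∨ y * h = y ∨ y * h = y⁻¹) ↔
        (h = 1 ∨ h = y ∨ h = y⁻¹) := by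
      intro h
      have e : y * y = y⁻¹ := by decide
      rw [mul_eq_left, mul_eq_one_iff_eq_inv', ← e, mul_right_inj, e]
      tauto
    -- `a * u` lies outside the triangle of `u`, so the layers of the two ends can be shifted
    -- independently.
    refine ⟨coverIso (u⁻¹ * v) (fun w => if w * u⁻¹ = 1 ∨ w * u⁻¹ = y ∨ w * u⁻¹ = y⁻¹ then i' - i
      else j' - j) fun w => ?_, ?_⟩
    · simp only [mul_assoc, hT]
    · have : ¬ (a = 1 ∨ a = y ∨ a = y⁻¹) := by decide
      simp [coverIso, this, mul_assoc]

theorem arcOrbit_triangle {p q : FrobeniusGroup × ZMod m} (h : q = (y * p.1, p.2)) :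
    arcOrbit (Y) (p, q) = triangleArcs m := by
  obtain ⟨u, i⟩ := p
  subst h
  ext ⟨⟨v, i'⟩, ⟨w, j'⟩⟩
  constructor
  · rintro ⟨φ, hφ⟩
    obtain ⟨ψ, hψ⟩ := exists_baseGraph_iso φ
    have h1 := hψ u i
    have h2 := hψ (y * u) i
    have h3 : (Y).Adj (φ (u, i)) (φ (y * u, i)) := φ.map_adj_iff.2 (cover_adj.2 (by simp))
    rw [Prod.mk.injEq] at hφ
    rw [hφ.1, hφ.2] at h3
    rw [hφ.1] at h1
    rw [hφ.2, (baseGraph_iso_apply ψ u).2, ← h1] at h2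
    obtain rfl : w = y * v := h2
    -- The projection forgets layers; adjacency along a `y`-edge shows that they agree.
    rw [cover_adj] at h3
    rcases h3 with h3 | h3
    · simp only [mul_left_inj] at h3
      exact absurd h3 (by decide)
    · exact Prod.ext rfl h3.2
  · intro h
    obtain ⟨rfl, rfl⟩ : w = y * v ∧ j' = i' := Prod.mk.inj h
    exact ⟨coverIso (u⁻¹ * v) (fun _ => j' - i) fun _ => rfl, by simp [coverIso, mul_assoc]⟩

theorem arcOrbit_swap {V : Type*} (X : SimpleGraph V) (u v : V) :
    arcOrbit X (v, u) = pairedOrbit (arcOrbit X (u, v)) := by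
  ext ⟨p, q⟩
  simp only [arcOrbit, pairedOrbit, Set.mem_ofPred_eq, Prod.mk.injEq]
  exact exists_congr fun φ => and_comm

theorem pairedOrbit_pairedOrbit {V : Type*} (Δ : Set (V × V)) :
    pairedOrbit (pairedOrbit Δ) = Δ := rfl

theorem mem_arcOrbits_cover {Δ : Set ((FrobeniusGroup × ZMod m) × (FrobeniusGroup × ZMod m))} :
    Δ ∈ arcOrbits (Y) ↔ Δ = sparseArcs m ∨ Δ = pairedOrbit (sparseArcs m) ∨
      Δ = triangleArcs m ∨ Δ = pairedOrbit (triangleArcs m) := by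
  constructor
  · rintro ⟨p, q, h, rfl⟩
    rw [cover_adj] at h
    rcases h with (h | h) | ⟨h | h, h'⟩
    · exact .inl (arcOrbit_sparse h)
    · rw [arcOrbit_swap, arcOrbit_sparse (by rw [h, mul_inv_cancel_left])]
      exact .inr (.inl rfl)
    · exact .inr (.inr (.inl (arcOrbit_triangle (Prod.ext h h'))))
    · rw [arcOrbit_swap, arcOrbit_triangle
        (Prod.ext (by rw [h, mul_inv_cancel_left]) h'.symm)]
      exact .inr (.inr (.inr rfl))
  · have h1 : (Y).Adj (1, 0) (a * 1, 0) := cover_adj.2 (by simp)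
    have h2 : (Y).Adj (1, 0) (y * 1, 0) := cover_adj.2 (by simp)
    rintro (rfl | rfl | rfl | rfl)
    · exact ⟨_, _, h1, (arcOrbit_sparse rfl).symm⟩
    · exact ⟨_, _, h1.symm, by rw [arcOrbit_swap, arcOrbit_sparse rfl]⟩
    · exact ⟨_, _, h2, (arcOrbit_triangle rfl).symm⟩
    · exact ⟨_, _, h2.symm, by rw [arcOrbit_swap, arcOrbit_triangle rfl]⟩

theorem localSize_sparseArcs [NeZero m] (v : FrobeniusGroup × ZMod m) :
    localSize v (sparseArcs m) = m := by
  have h : {w | (v, w) ∈ sparseArcs m} = ({a * v.1} : Set _) ×ˢ (Set.univ : Set (ZMod m)) := by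
    ext w
    simp [sparseArcs]
  rw [localSize, h, Set.ncard_prod, Set.ncard_singleton, Set.ncard_univ, Nat.card_zmod, one_mul]

theorem localSize_triangleArcs (v : FrobeniusGroup × ZMod m) :
    localSize v (triangleArcs m) = 1 :=
  Set.ncard_singleton (y * v.1, v.2)

theorem cover_hasArcType (hm : 2 ≤ m) :
    HasArcType (Y) { single := 0, bracketed := {m, 1} } := by
  classical
  have : NeZero m := ⟨by omega⟩
  have hx : pairedOrbit (sparseArcs m) ≠ sparseArcs m := fun h => by
    have h1 : (((1 : FrobeniusGroup), (0 : ZMod m)), (a, (0 : ZMod m))) ∈ sparseArcs m := by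
      simp [sparseArcs]
    rw [← h] at h1
    have h2 : (1 : FrobeniusGroup) = a * a := h1
    revert h2
    decide
  have hy : pairedOrbit (triangleArcs m) ≠ triangleArcs m := fun h => by
    have h1 : (((1 : FrobeniusGroup), (0 : ZMod m)), (y, (0 : ZMod m))) ∈ triangleArcs m := by
      simp [triangleArcs]
    rw [← h] at h1
    have h2 : (1 : FrobeniusGroup) = y * y := congrArg Prod.fst h1
    revert h2
    decide
  -- The local sizes `m` and 1 differ.
  have hne : sparseArcs m ≠ triangleArcs m := fun h => by
    have h1 := localSize_sparseArcs (m := m) (1, 0)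
    rw [h, localSize_triangleArcs] at h1
    omega
  have hne' : pairedOrbit (sparseArcs m) ≠ triangleArcs m := fun h => by
    have h1 : (((1 : FrobeniusGroup), (0 : ZMod m)), (y, (0 : ZMod m))) ∈ triangleArcs m := by
      simp [triangleArcs]
    rw [← h] at h1
    have h2 : (1 : FrobeniusGroup) = a * y := h1
    revert h2
    decide
  have hne'' : pairedOrbit (triangleArcs m) ≠ sparseArcs m := fun h => hne' (by rw [← h]; rfl)
  refine ⟨∅, {sparseArcs m, triangleArcs m}, ?_, ?_, ?_, ?_⟩
  · intro Δ
    simp only [Finset.notMem_empty, false_iff, not_and, mem_arcOrbits_cover]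
    rintro (rfl | rfl | rfl | rfl)
    · exact hx
    · exact hx.symm
    · exact hy
    · exact hy.symm
  · intro Δ hΔ
    simp only [Finset.mem_insert, Finset.mem_singleton] at hΔ ⊢
    rcases hΔ with rfl | rfl
    · exact ⟨mem_arcOrbits_cover.2 (.inl rfl), hx, not_or.2 ⟨hx, hne'⟩⟩
    · exact ⟨mem_arcOrbits_cover.2 (.inr (.inr (.inl rfl))), hy, not_or.2 ⟨hne'', hy⟩⟩
  · intro Δ hΔ _
    simp only [Finset.mem_insert, Finset.mem_singleton]
    rcases mem_arcOrbits_cover.1 hΔ with rfl | rfl | rfl | rfl <;>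
      simp [pairedOrbit_pairedOrbit]
  · intro v
    refine ⟨rfl, ?_⟩
    rw [Finset.insert_val_of_notMem (by simpa using hne), Multiset.map_cons,
      Finset.singleton_val, Multiset.map_singleton, localSize_sparseArcs, localSize_triangleArcs]
    rfl

theorem cover_connected : (Y).Connected := by
  have reach : ∀ u i j, (Y).Reachable (1, 0) (u, i) → (Y).Reachable (1, 0) (a * u, j) :=
    fun u i j h => h.trans (SimpleGraph.Adj.reachable (cover_adj.2 (by simp)))
  have h : ∀ u, ∀ i, (Y).Reachable (1, 0) (u, i) := by
    refine generators_induction (fun i => ?_) (fun u hu i => reach u i i (hu i)) (fun u hu i => ?_)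
    -- Going along an `a`-edge and back reaches any layer.
    · have h1 : (Y).Adj (1, 0) (a, i) := cover_adj.2 (by simp)
      have h2 : (Y).Adj (a, i) (1, i) := cover_adj.2 (by simp)
      exact h1.reachable.trans h2.reachable
    · exact (hu i).trans (SimpleGraph.Adj.reachable (cover_adj.2 (by simp)))
  exact SimpleGraph.connected_iff_exists_forall_reachable _ |>.2 ⟨(1, 0), fun p => h p.1 p.2⟩

/-! ### Primality with respect to the Cartesian product -/

/-- A colouring of the arcs has the square property if any two edges at a vertex that have
different colours span a unique square, which has no diagonal and whose opposite sides have the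
same colour. -/
def SquareProperty {V : Type*} (X : SimpleGraph V) (c : V → V → Prop) : Prop :=
  ∀ p q r, X.Adj p q → X.Adj p r → c p q → ¬ c p r → ¬ X.Adj q r ∧
    ∃ s, X.Adj q s ∧ X.Adj r s ∧ ¬ c q s ∧ c r s ∧
      ∀ t, X.Adj q t → X.Adj r t → t = p ∨ t = s

theorem SquareProperty.compl {V : Type*} {X : SimpleGraph V} {c : V → V → Prop}
    (sq : SquareProperty X c) : SquareProperty X fun p q => ¬ c p q := by
  intro p q r hq hr h1 h2
  obtain ⟨h, s, h3, h4, h5, h6, h7⟩ := sq p r q hr hq (not_not.1 h2) h1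
  exact ⟨fun h' => h h'.symm, s, h4, h3, not_not.2 h6, h5, fun t ht ht' => h7 t ht' ht⟩

/-- The colouring of the edges of a Cartesian product according to the factor they come from has
the square property. -/
theorem squareProperty_boxProd {V A B : Type*} {X : SimpleGraph V} {H : SimpleGraph A}
    {K : SimpleGraph B} (f : X ≃g H.boxProd K) :
    SquareProperty X fun p q => (f p).2 = (f q).2 := by
  intro p q r
  obtain ⟨p, rfl⟩ := f.symm.surjective p
  obtain ⟨q, rfl⟩ := f.symm.surjective q
  obtain ⟨r, rfl⟩ := f.symm.surjective r
  simp only [f.symm.surjective.exists, f.symm.surjective.forall, f.symm.map_adj_iff,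
    f.apply_symm_apply, f.symm.injective.eq_iff]
  obtain ⟨p₁, p₂⟩ := p
  obtain ⟨q₁, q₂⟩ := q
  obtain ⟨r₁, r₂⟩ := r
  simp only [SimpleGraph.boxProd_adj]
  rintro hq hr rfl h
  obtain ⟨hpr, rfl⟩ : K.Adj p₂ r₂ ∧ p₁ = r₁ := hr.resolve_left fun h' => h h'.2
  obtain ⟨hpq, -⟩ : H.Adj p₁ q₁ ∧ _ := hq.resolve_right fun h' => K.irrefl h'.1
  refine ⟨?_, (q₁, r₂), .inr ⟨hpr, rfl⟩, .inl ⟨hpq, rfl⟩, h, rfl, ?_⟩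
  · rintro (⟨-, h'⟩ | ⟨-, h'⟩)
    · exact h h'
    · exact hpq.ne h'.symm
  · rintro ⟨t₁, t₂⟩ (⟨-, h1⟩ | ⟨-, h1⟩) (⟨-, h2⟩ | ⟨-, h2⟩) <;> dsimp only at h1 h2 <;> subst h1
    · exact absurd h2.symm h
    · subst h2
      exact .inl rfl
    · subst h2
      exact .inr rfl
    · exact absurd h2 hpq.ne

theorem exists_ne_of_two_le (hm : 2 ≤ m) (i : ZMod m) : ∃ j, j ≠ i := by
  have : Fact (1 < m) := ⟨hm⟩
  exact exists_ne i

/-- All edges of the cover at a vertex that lie in no triangle have the same colour. -/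
theorem colour_sparse (hm : 2 ≤ m) {c : FrobeniusGroup × ZMod m → FrobeniusGroup × ZMod m → Prop}
    (symm : ∀ p q, c p q → c q p) (sq : SquareProperty (Y) c) {p q r : FrobeniusGroup × ZMod m}
    (hq : q.1 = a * p.1 ∨ q.1 = a⁻¹ * p.1) (hr : r.1 = a * p.1 ∨ r.1 = a⁻¹ * p.1)
    (h : c p q) : c p r := by
  have back : ∀ {p q t : FrobeniusGroup × ZMod m}, (q.1 = a * p.1 ∨ q.1 = a⁻¹ * p.1) →
      t.1 = p.1 → (t.1 = a * q.1 ∨ t.1 = a⁻¹ * q.1) := by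
    rintro p q t (h | h) ht <;> simp [h, ht]
  -- Two neighbours of `p` in one fibre share three neighbours: `p`, another vertex of its fibre,
  -- and one over the next vertex `z` of the `a`-cycle. A unique square allows only two.
  have fan : ∀ {p q r : FrobeniusGroup × ZMod m}, (q.1 = a * p.1 ∨ q.1 = a⁻¹ * p.1) →
      r.1 = q.1 → c p q → c p r := by
    intro p q r hq hr h
    by_contra h'
    obtain ⟨-, s, -, -, -, -, hs⟩ :=
      sq p q r (cover_adj.2 (.inl hq)) (cover_adj.2 (.inl (by rwa [hr]))) h h'
    obtain ⟨j, hj⟩ := exists_ne_of_two_le hm p.2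
    have hq' := back (t := (p.1, j)) hq rfl
    have h1 := hs (p.1, j) (cover_adj.2 (.inl hq')) (cover_adj.2 (.inl (by rwa [hr])))
    obtain ⟨z, hz, hzp⟩ : ∃ z, (z = a * q.1 ∨ z = a⁻¹ * q.1) ∧ z ≠ p.1 := by
      rcases hq with hq | hq
      · refine ⟨_, .inl rfl, ?_⟩
        rw [hq, ← mul_assoc, Ne, mul_eq_right]
        decide
      · refine ⟨_, .inr rfl, ?_⟩
        rw [hq, ← mul_assoc, Ne, mul_eq_right]
        decide
    have h2 := hs (z, 0) (cover_adj.2 (.inl hz)) (cover_adj.2 (.inl (by rwa [hr])))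
    rcases h1 with h1 | h1
    · exact hj (congrArg Prod.snd h1)
    rcases h2 with h2 | h2
    · exact hzp (congrArg Prod.fst h2)
    · exact hzp (congrArg Prod.fst (h2.trans h1.symm))
  by_contra h'
  obtain ⟨-, s, -, -, h1, -, hs⟩ :=
    sq p q r (cover_adj.2 (.inl hq)) (cover_adj.2 (.inl hr)) h h'
  obtain ⟨j, hj⟩ := exists_ne_of_two_le hm p.2
  -- The fourth corner must be `(p.1, j)`, but `fan` at `q` gives its edge to `q` the colour of `p
  -- q`, not that of `p r`.
  rcases hs (p.1, j) (cover_adj.2 (.inl (back hq rfl))) (cover_adj.2 (.inl (back hr rfl)))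
    with h2 | h2
  · exact hj (congrArg Prod.snd h2)
  · rw [← h2] at h1
    exact h1 (fan (back hq rfl) rfl (symm _ _ h))

/-- The two edges of the cover at a vertex that lie in a triangle have the same colour. -/
theorem colour_triangle {c : FrobeniusGroup × ZMod m → FrobeniusGroup × ZMod m → Prop}
    (sq : SquareProperty (Y) c) {p q r : FrobeniusGroup × ZMod m}
    (hq : (q.1 = y * p.1 ∨ q.1 = y⁻¹ * p.1) ∧ q.2 = p.2)
    (hr : (r.1 = y * p.1 ∨ r.1 = y⁻¹ * p.1) ∧ r.2 = p.2) (h : c p q) : c p r := by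
  by_contra h'
  obtain ⟨hqr, -⟩ := sq p q r (cover_adj.2 (.inr hq)) (cover_adj.2 (.inr hr)) h h'
  have e : y * y = y⁻¹ := by decide
  have e' : y⁻¹ * y⁻¹ = y := by decide
  have h2 : r.2 = q.2 := hr.2.trans hq.2.symm
  rcases hq.1 with h3 | h3 <;> rcases hr.1 with h4 | h4
  · exact h' (by rwa [Prod.ext (h4.trans h3.symm) h2])
  · exact hqr (cover_adj.2 (.inr ⟨.inl (by rw [h3, h4, ← mul_assoc, e]), h2⟩))
  · exact hqr (cover_adj.2 (.inr ⟨.inr (by rw [h3, h4, ← mul_assoc, e']), h2⟩))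
  · exact h' (by rwa [Prod.ext (h4.trans h3.symm) h2])

/-- Otherwise `a * p.1` and `y * p.1` lie in a square whose opposite sides are of the same type, so
`y` or `y⁻¹` times `a` equals `a` or `a⁻¹` times `y`; none of these four equations holds. -/
theorem colour_sparse_triangle (hm : 2 ≤ m)
    {c : FrobeniusGroup × ZMod m → FrobeniusGroup × ZMod m → Prop}
    (symm : ∀ p q, c p q → c q p) (sq : SquareProperty (Y) c) {p q r : FrobeniusGroup × ZMod m}
    (hq : q.1 = a * p.1 ∨ q.1 = a⁻¹ * p.1)
    (hr : (r.1 = y * p.1 ∨ r.1 = y⁻¹ * p.1) ∧ r.2 = p.2) (h : c p q) : c p r := by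
  refine colour_triangle sq (q := (y * p.1, p.2)) ⟨.inl rfl, rfl⟩ hr ?_
  by_contra h'
  obtain ⟨-, s, h1, h2, h3, h4, -⟩ := sq p (a * p.1, 0) (y * p.1, p.2)
    (cover_adj.2 (.inl (.inl rfl))) (cover_adj.2 (.inr ⟨.inl rfl, rfl⟩))
    (colour_sparse hm symm sq hq (.inl rfl) h) h'
  have h5 := (cover_adj.1 h1).resolve_left fun h5 =>
    h3 (colour_sparse hm symm sq (by simp) h5
      (symm _ _ (colour_sparse hm symm sq hq (.inl rfl) h)))
  have h6 := (cover_adj.1 h2).resolve_right fun h6 =>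
    h' (symm _ _ (colour_triangle sq h6 (by simp) h4))
  rcases h5.1 with h5 | h5 <;> rcases h6 with h6 | h6 <;>
  · have h7 := h5.symm.trans h6
    simp only [← mul_assoc, mul_left_inj] at h7
    revert h7
    decide

/-- All edges of the cover at a vertex have the same colour. -/
theorem colour_eq (hm : 2 ≤ m) {c : FrobeniusGroup × ZMod m → FrobeniusGroup × ZMod m → Prop}
    (symm : ∀ p q, c p q → c q p) (sq : SquareProperty (Y) c) {p q r : FrobeniusGroup × ZMod m}
    (hq : (Y).Adj p q) (hr : (Y).Adj p r) (h : c p q) : c p r := by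
  rcases cover_adj.1 hq with hq | hq <;> rcases cover_adj.1 hr with hr | hr
  · exact colour_sparse hm symm sq hq hr h
  · exact colour_sparse_triangle hm symm sq hq hr h
  · by_contra h'
    -- The same lemma for the complementary colouring.
    exact colour_sparse_triangle hm (fun p q h1 h2 => h1 (symm _ _ h2)) sq.compl hr hq h' h
  · exact colour_triangle sq hq hr h

theorem cover_isCartesianPrime (hm : 2 ≤ m) : IsCartesianPrime (Y) := by
  refine ⟨SimpleGraph.ne_bot_iff_exists_adj.2
    ⟨(1, 0), (a * 1, 0), cover_adj.2 (.inl (.inl rfl))⟩, fun A B H K hH hK => ⟨fun f => ?_⟩⟩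
  obtain ⟨h, h', hh⟩ := SimpleGraph.ne_bot_iff_exists_adj.1 hH
  obtain ⟨k, k', hk⟩ := SimpleGraph.ne_bot_iff_exists_adj.1 hK
  have h1 : (Y).Adj (f.symm (h, k)) (f.symm (h', k)) :=
    f.symm.map_adj_iff.2 (SimpleGraph.boxProd_adj.2 (.inl ⟨hh, rfl⟩))
  have h2 : (Y).Adj (f.symm (h, k)) (f.symm (h, k')) :=
    f.symm.map_adj_iff.2 (SimpleGraph.boxProd_adj.2 (.inr ⟨hk, rfl⟩))
  -- One edge from each factor at `(h, k)`: they have different colours.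
  have h3 := colour_eq hm (fun _ _ => Eq.symm) (squareProperty_boxProd f) h1 h2
    (by simp only [f.apply_symm_apply])
  simp only [f.apply_symm_apply] at h3
  exact hk.ne h3

end Cover

/-! ### The edge orbit and the conclusion -/

theorem isEdgeOrbit_trianglelessEdges_baseGraph :
    IsEdgeOrbit baseGraph (trianglelessEdges baseGraph) := by
  have mem : s(1, a) ∈ trianglelessEdges baseGraph := mem_trianglelessEdges_baseGraph.2 (by simp)
  refine ⟨s(1, a), (mem_trianglelessEdges.1 mem).1, ?_⟩
  have trans : ∀ u, ∃ φ : baseGraph ≃g baseGraph, φ 1 = u ∧ φ a = a * u := fun u =>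
    ⟨⟨Equiv.mulRight u, by simp [baseGraph_adj, ← mul_assoc]⟩, one_mul u, rfl⟩
  ext e
  induction e with | _ u v
  constructor
  · intro h
    rcases mem_trianglelessEdges_baseGraph.1 h with rfl | rfl
    · obtain ⟨φ, h1, h2⟩ := trans u
      exact ⟨φ, by simp [h1, h2]⟩
    · obtain ⟨φ, h1, h2⟩ := trans (a⁻¹ * u)
      exact ⟨φ, by simp [h1, h2, Sym2.eq_swap]⟩
  · rintro ⟨φ, h⟩
    rw [← h, Sym2.map_mk]
    exact (map_mem_trianglelessEdges φ).2 mem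

theorem lemma8p7 (m : ℕ) (hm : 2 ≤ m) :
    IsEdgeOrbit baseGraph (trianglelessEdges baseGraph) ∧
    (thickenedCover baseGraph (trianglelessEdges baseGraph) m).Connected ∧
    IsVertexTransitive (thickenedCover baseGraph (trianglelessEdges baseGraph) m) ∧
    HasArcType (thickenedCover baseGraph (trianglelessEdges baseGraph) m)
      { single := 0, bracketed := {m, 1} } ∧
    IsCartesianPrime (thickenedCover baseGraph (trianglelessEdges baseGraph) m) ∧
    ∀ φ : thickenedCover baseGraph (trianglelessEdges baseGraph) m ≃g
        thickenedCover baseGraph (trianglelessEdges baseGraph) m,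
      ∃ ψ : baseGraph ≃g baseGraph, ∀ (u : FrobeniusGroup) (i : ZMod m),
        (φ (u, i)).1 = ψ u :=
  ⟨isEdgeOrbit_trianglelessEdges_baseGraph, cover_connected, cover_isVertexTransitive,
    cover_hasArcType hm, cover_isCartesianPrime hm, exists_baseGraph_iso⟩
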